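/- For graphs $H,G$ let $\mathcal N(H,G)$ be the number of (not necessarily induced) subgraphs of $G$ isomorphic to $H$, and let $\mathrm{ex}(n,H,F)$ be the maximum of $\mathcal N(H,G)$ over $F$-free graphs $G$ on $n$ vertices. Put $\mathcal N(H_1,\dots,H_k;G)=\sum_{i=1}^k\mathcal N(H_i,G)$, and let $\mathrm{ex}(n,(H_1,\dots,H_k),F)$ be its maximum over $F$-free graphs $G$ on $n$ vertices. If the edges of $G$ are colored with colors $1,\dots,k$ and $G_i$ is the subgraph formed by the edges of color $i$, put $\mathcal N^{\mathrm{col}}(H_1,\dots,H_k;G)=\sum_{i=1}^k\mathcal N(H_i,G_i)$, and let $\mathrm{ex}^{\mathrm{col}}(n,(H_1,\dots,H_k),F)$ be its maximum over all $F$-free graphs $G$ on $n$ vertices with all colorings of their edges by $1,\dots,k$. The tuple $(H_1,\dots,H_k,F)$ is *color-resistant* for $n$ if $\mathrm{ex}^{\mathrm{col}}(n,(H_1,\dots,H_k),F)=\max_{i\le k}\mathrm{ex}(n,H_i,F)$. It is *resistant* for $n$ if there is an $n$-vertex $F$-free graph $G$ with $\mathcal N(H_j,G)=\max_{i\le k}\mathrm{ex}(n,H_i,F)$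 for some $j$, and every such graph $G$ satisfies $\mathrm{ex}(n,(H_1,\dots,H_k),F)=\mathcal N(H_1,\dots,H_k;G)$. Let $P_4$ be the path on $4$ vertices, $K_3$ the triangle, $C_5$ the cycle of length $5$, and $T_2(n)$ the complete bipartite graph on $n$ vertices with parts of sizes $\lfloor n/2\rfloor$ and $\lceil n/2\rceil$. **Proposition.** For every sufficiently large $n$, the triple $(P_4,K_3,C_5)$ is both resistant and color-resistant for $n$. Moreover, for every sufficiently large $n$, the $C_5$-free graph $T_2(n)$ attains both maxima: $\mathrm{ex}(n,(P_4,K_3),C_5)=\mathcal N(P_4,K_3;T_2(n))$, and $\mathrm{ex}^{\mathrm{col}}(n,(P_4,K_3),C_5)=\mathcal N^{\mathrm{col}}(P_4,K_3;T_2(n))$ when all edges of $T_2(n)$ have color $1$ (the color assigned to $P_4$). -/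

import Mathlib

namespace GenTuran

open SimpleGraph

/-- A finite graph, given on the vertex set `Fin m`. -/
abbrev FinGraph : Type := Σ m : ℕ, SimpleGraph (Fin m)

/-- `𝒩(H₁, …, H_k; G) = ∑ i, 𝒩(H_i, G)`, where `𝒩(H, G)` is the number of (not necessarily
induced) subgraphs of `G` isomorphic to `H`. -/
noncomputable def count {k n : ℕ} (H : Fin k → FinGraph) (G : SimpleGraph (Fin n)) : ℕ :=
  ∑ i, G.copyCount (H i).2

/-- `𝒩ᶜᵒˡ(H₁, …, H_k; G) = ∑ i, 𝒩(H_i, G_i)` for a graph `G` with edges colored by `k` colors,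
where `G_i` consists of the edges of color `i`. -/
noncomputable def colCount {k n : ℕ} (H : Fin k → FinGraph) {G : SimpleGraph (Fin n)}
    (c : G.EdgeLabeling (Fin k)) : ℕ :=
  ∑ i, (c.labelGraph i).copyCount (H i).2

open scoped Classical in
/-- The finite set of `F`-free graphs on `n` vertices. -/
noncomputable def freeGraphs (n : ℕ) (F : FinGraph) : Finset (SimpleGraph (Fin n)) :=
  {G | F.2.Free G}

/-- `ex(n, H, F)`: the largest number of copies of `H` in an `F`-free graph on `n` vertices. -/
noncomputable def ex (n : ℕ) (H F : FinGraph) : ℕ :=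
  (freeGraphs n F).sup fun G => G.copyCount H.2

/-- `ex(n, (H₁, …, H_k), F)`: the largest `𝒩(H₁, …, H_k; G)` over `F`-free graphs `G` on `n`
vertices. -/
noncomputable def exTuple {k : ℕ} (n : ℕ) (H : Fin k → FinGraph) (F : FinGraph) : ℕ :=
  (freeGraphs n F).sup fun G => count H G

open scoped Classical in
/-- `exᶜᵒˡ(n, (H₁, …, H_k), F)`: the largest `𝒩ᶜᵒˡ(H₁, …, H_k; G)` over `F`-free graphs `G` on `n`
vertices with edges colored by `k` colors. -/
noncomputable def exCol {k : ℕ} (n : ℕ) (H : Fin k → FinGraph) (F : FinGraph) : ℕ :=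
  (freeGraphs n F).sup fun G =>
    (Finset.univ : Finset (G.EdgeLabeling (Fin k))).sup fun c => colCount H c

/-- `max_{i ≤ k} ex(n, H_i, F)`. -/
noncomputable def maxEx {k : ℕ} (n : ℕ) (H : Fin k → FinGraph) (F : FinGraph) : ℕ :=
  Finset.univ.sup fun i => ex n (H i) F

/-- `G` is an `F`-free graph with `𝒩(H_j, G) = max_{i ≤ k} ex(n, H_i, F)` for some `j`. -/
def AttainsMaxEx {k n : ℕ} (H : Fin k → FinGraph) (F : FinGraph) (G : SimpleGraph (Fin n)) : Prop :=
  F.2.Free G ∧ ∃ j, G.copyCount (H j).2 = maxEx n H F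

/-- `(H₁, …, H_k, F)` is resistant for `n`: a graph `G` that attains `max_{i ≤ k} ex(n, H_i, F)`
also attains `ex(n, (H₁, …, H_k), F)`. Such graphs `G` exist, and all of them have this property. -/
def IsResistant {k : ℕ} (n : ℕ) (H : Fin k → FinGraph) (F : FinGraph) : Prop :=
  (∃ G : SimpleGraph (Fin n), AttainsMaxEx H F G) ∧
    ∀ G : SimpleGraph (Fin n), AttainsMaxEx H F G → exTuple n H F = count H G

/-- `(H₁, …, H_k, F)` is color-resistant for `n`. -/
def IsColorResistant {k : ℕ} (n : ℕ) (H : Fin k → FinGraph) (F : FinGraph) : Prop :=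
  exCol n H F = maxEx n H F

/-- The coloring of all edges of `G` with the color `i`. -/
def monochromatic {k n : ℕ} (G : SimpleGraph (Fin n)) (i : Fin k) : G.EdgeLabeling (Fin k) :=
  fun _ => i

/-- The path `P_ℓ` on `ℓ` vertices. -/
def P (l : ℕ) : FinGraph := ⟨l, pathGraph l⟩

/-- The complete graph `K_r`. -/
def K (r : ℕ) : FinGraph := ⟨r, completeGraph (Fin r)⟩

/-- The cycle `C_ℓ`, for `ℓ ≥ 3`. -/
def C (l : ℕ) : FinGraph := ⟨l, cycleGraph l⟩

end GenTuran

/-! Everything rests on one inequality for large `n` (`exists_copyCount_add_le`): a `C₅`-free graph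
has at most as many copies of `P₄` and `K₃` together as `T₂(n)` has of `P₄` alone. Since color
classes are subgraphs, all the maxima involved then equal this number.

For a triangle-free graph, paths are counted by their middle edge `bc`: `deg b + deg c ≤ n` and
Mantel's bound on the edges give the extremal value at once. A `C₅`-free graph with a triangle has a
vertex `v`, of degree `δ` say, from which at most `δn - 2δ² + 12n` walks of length two start
(`exists_sum_degree_neighborFinset_add_le`). So `v` lies in at most `2n³/5 + O(n²)` labelled paths
and `O(n²)` labelled triangles, while the labelled path count of `T₂(n)` exceeds that of `T₂(n-1)`
by about `n³/2`. Each such deletion therefore costs strictly less than the bound drops, and in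
enough steps this absorbs any excess left on a bounded number of vertices. -/

namespace GenTuran
open SimpleGraph Finset

/-! ### Labelled and unlabelled copies -/

/-- The copies of `H` with a given image `B` correspond to the isomorphisms from `H` to `B`. -/
theorem natCard_copy_toSubgraph_eq {V W : Type*} {G : SimpleGraph V} {H : SimpleGraph W}
    (f : H.Copy G) :
    Nat.card {g : H.Copy G // g.toSubgraph = f.toSubgraph} = Nat.card (H ≃g H) := by
  let φ : (H ≃g H) → {g : H.Copy G // g.toSubgraph = f.toSubgraph} := fun e =>
    ⟨⟨f.toSubgraph.hom.comp (f.isoToSubgraph.toHom.comp e.toHom),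
      Subgraph.hom_injective.comp (f.isoToSubgraph.injective.comp e.injective)⟩, by
        simp [Copy.toSubgraph, Subgraph.map_comp]⟩
  refine (Nat.card_eq_of_bijective φ ⟨?_, ?_⟩).symm
  · intro e₁ e₂ h
    ext x
    have := congrArg (fun g => g.1 x) h
    exact f.isoToSubgraph.injective (Subgraph.hom_injective this)
  · rintro ⟨g, hg⟩
    have key : ∀ (B : G.Subgraph), g.toSubgraph = B →
        ∃ e : H ≃g B.coe, ∀ x, ((e x : B.verts) : V) = g x := by
      rintro _ rfl
      exact ⟨g.isoToSubgraph, fun x => rfl⟩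
    obtain ⟨e, he⟩ := key _ hg
    refine ⟨e.trans f.isoToSubgraph.symm, Subtype.ext (Copy.ext fun x => ?_)⟩
    rw [← he x]
    change ((f.isoToSubgraph (f.isoToSubgraph.symm (e x)) : f.toSubgraph.verts) : V) = _
    rw [f.isoToSubgraph.apply_symm_apply]

theorem labelledCopyCount_eq_natCard {V W : Type*} [Fintype V] [Fintype W] (G : SimpleGraph V)
    (H : SimpleGraph W) : G.labelledCopyCount H = Nat.card (H.Copy G) := by
  classical
  rw [labelledCopyCount, Nat.card_eq_fintype_card]

theorem labelledCopyCount_eq_mul {V W : Type*} [Fintype V] [Fintype W] (G : SimpleGraph V)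
    (H : SimpleGraph W) :
    G.labelledCopyCount H = G.copyCount H * Nat.card (H ≃g H) := by
  classical
  rw [copyCount_eq_card_image_copyToSubgraph]
  rw [labelledCopyCount, ← card_univ, card_eq_sum_card_image Copy.toSubgraph]
  refine sum_const_nat fun B hB => ?_
  obtain ⟨f, -, rfl⟩ := mem_image.1 hB
  rw [← natCard_copy_toSubgraph_eq f, Nat.card_eq_fintype_card, Fintype.card_subtype]

theorem natCard_iso_self_pos {W : Type*} [Finite W] (H : SimpleGraph W) :
    0 < Nat.card (H ≃g H) := by
  have : Finite (H ≃g H) := Finite.of_injective (fun e => e.toEquiv) RelIso.toEquiv_injective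
  have : Nonempty (H ≃g H) := ⟨Iso.refl⟩
  exact Nat.card_pos

/-- Labelled copies in `G` inject into those in `G'`; dividing by the number of automorphisms of `H`
transfers this to copies. It is needed to compare a color class with the whole graph. -/
theorem copyCount_mono {V W : Type*} [Fintype V] [Fintype W] {G G' : SimpleGraph V}
    (h : G ≤ G') (H : SimpleGraph W) : G.copyCount H ≤ G'.copyCount H := by
  have hl : G.labelledCopyCount H ≤ G'.labelledCopyCount H := by
    classical
    rw [labelledCopyCount, labelledCopyCount]
    refine Fintype.card_le_of_injective (fun f => (Copy.ofLE _ _ h).comp f) fun f g hfg => ?_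
    ext x
    exact congrArg (fun k => k x) hfg
  rw [labelledCopyCount_eq_mul, labelledCopyCount_eq_mul] at hl
  exact Nat.le_of_mul_le_mul_right hl (natCard_iso_self_pos H)

/-! ### Labelled paths, triangles and five-cycles as tuples of vertices -/

open scoped Classical in
/-- The labelled paths on four vertices in `G`. -/
noncomputable def labelledPaths {V : Type*} [Fintype V] (G : SimpleGraph V) :
    Finset (V × V × V × V) :=
  {q | G.Adj q.1 q.2.1 ∧ G.Adj q.2.1 q.2.2.1 ∧ G.Adj q.2.2.1 q.2.2.2 ∧
    q.1 ≠ q.2.2.1 ∧ q.2.1 ≠ q.2.2.2 ∧ q.1 ≠ q.2.2.2}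

open scoped Classical in
/-- The labelled triangles in `G`. -/
noncomputable def labelledTriangles {V : Type*} [Fintype V] (G : SimpleGraph V) :
    Finset (V × V × V) :=
  {q | G.Adj q.1 q.2.1 ∧ G.Adj q.2.1 q.2.2 ∧ G.Adj q.1 q.2.2}

theorem mem_labelledPaths {V : Type*} [Fintype V] {G : SimpleGraph V} {a b c d : V} :
    (a, b, c, d) ∈ labelledPaths G ↔
      G.Adj a b ∧ G.Adj b c ∧ G.Adj c d ∧ a ≠ c ∧ b ≠ d ∧ a ≠ d := by
  simp [labelledPaths]

theorem mem_labelledTriangles {V : Type*} [Fintype V] {G : SimpleGraph V} {a b c : V} :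
    (a, b, c) ∈ labelledTriangles G ↔ G.Adj a b ∧ G.Adj b c ∧ G.Adj a c := by
  simp [labelledTriangles]

theorem labelledCopyCount_pathGraph_four {V : Type*} [Fintype V] (G : SimpleGraph V) :
    G.labelledCopyCount (pathGraph 4) = #(labelledPaths G) := by
  have hmem (f : (pathGraph 4).Copy G) : (f 0, f 1, f 2, f 3) ∈ labelledPaths G := by
    have h (i j : Fin 4) (hij : i ≠ j) : f i ≠ f j := fun e => hij (f.injective e)
    have h' (i j : Fin 4) (hij : (pathGraph 4).Adj i j) : G.Adj (f i) (f j) := f.toHom.map_adj hij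
    refine mem_labelledPaths.2 ⟨h' _ _ ?_, h' _ _ ?_, h' _ _ ?_, h _ _ ?_, h _ _ ?_, h _ _ ?_⟩ <;>
      simp [pathGraph_adj]
  rw [labelledCopyCount_eq_natCard, ← Nat.card_eq_finsetCard]
  refine Nat.card_eq_of_bijective (fun f => ⟨(f 0, f 1, f 2, f 3), hmem f⟩) ⟨?_, ?_⟩
  · intro f g h
    have h := congrArg Subtype.val h
    simp only [Prod.mk.injEq] at h
    refine Copy.ext fun i => ?_
    match i with
    | 0 => exact h.1
    | 1 => exact h.2.1
    | 2 => exact h.2.2.1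
    | 3 => exact h.2.2.2
  · rintro ⟨⟨a, b, c, d⟩, h⟩
    obtain ⟨hab, hbc, hcd, hac, hbd, had⟩ := mem_labelledPaths.1 h
    have hadj : ∀ {i j : Fin 4}, (pathGraph 4).Adj i j →
        G.Adj (![a, b, c, d] i) (![a, b, c, d] j) := by
      intro i j hij
      rw [pathGraph_adj] at hij
      fin_cases i <;> fin_cases j <;> simp_all [G.adj_comm]
    have hinj : Function.Injective ![a, b, c, d] := by
      have := hab.ne; have := hbc.ne; have := hcd.ne
      intro i j hij
      fin_cases i <;> fin_cases j <;> simp_all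
    exact ⟨⟨⟨![a, b, c, d], hadj⟩, hinj⟩, rfl⟩

theorem labelledCopyCount_completeGraph_three_le {V : Type*} [Fintype V] (G : SimpleGraph V) :
    G.labelledCopyCount (completeGraph (Fin 3)) ≤ #(labelledTriangles G) := by
  have hmem (f : (completeGraph (Fin 3)).Copy G) : (f 0, f 1, f 2) ∈ labelledTriangles G := by
    have h' (i j : Fin 3) (hij : i ≠ j) : G.Adj (f i) (f j) := f.toHom.map_adj hij
    refine mem_labelledTriangles.2 ⟨h' _ _ ?_, h' _ _ ?_, h' _ _ ?_⟩ <;> decide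
  rw [labelledCopyCount_eq_natCard, ← Nat.card_eq_finsetCard]
  refine Nat.card_le_card_of_injective (fun f => ⟨(f 0, f 1, f 2), hmem f⟩) ?_
  intro f g h
  have h := congrArg Subtype.val h
  simp only [Prod.mk.injEq] at h
  refine Copy.ext fun i => ?_
  match i with
  | 0 => exact h.1
  | 1 => exact h.2.1
  | 2 => exact h.2.2

theorem not_cycle_five {V : Type*} {G : SimpleGraph V} (hG : (cycleGraph 5).Free G)
    {a b c d e : V} (hab : G.Adj a b) (hbc : G.Adj b c) (hcd : G.Adj c d) (hde : G.Adj d e)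
    (hea : G.Adj e a) (hac : a ≠ c) (had : a ≠ d) (hbd : b ≠ d) (hbe : b ≠ e) (hce : c ≠ e) :
    False := by
  refine hG ⟨⟨⟨![a, b, c, d, e], ?_⟩, ?_⟩⟩
  · intro i j hij
    rw [cycleGraph_adj] at hij
    fin_cases i <;> fin_cases j <;> first
      | exact absurd hij (by decide)
      | simp_all [G.adj_comm]
  · have := hab.ne; have := hbc.ne; have := hcd.ne; have := hde.ne; have := hea.ne
    intro i j hij
    fin_cases i <;> fin_cases j <;> simp_all

theorem turanGraph_two_cycle_five_free (n : ℕ) : (cycleGraph 5).Free (turanGraph n 2) := by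
  rintro ⟨f⟩
  have h (i j : Fin 5) (hij : (cycleGraph 5).Adj i j) : (f i : ℕ) % 2 ≠ f j % 2 :=
    f.toHom.map_adj hij
  have h0 := h 0 1 (by decide)
  have h1 := h 1 2 (by decide)
  have h2 := h 2 3 (by decide)
  have h3 := h 3 4 (by decide)
  have h4 := h 4 0 (by decide)
  -- The parity of the vertices would alternate around an odd cycle.
  omega

/-! ### The triangle-free case -/

/-- The number of paths on four vertices in the balanced complete bipartite graph. -/
def bipartitePaths (n : ℕ) : ℕ := n / 2 * ((n + 1) / 2) * ((n / 2 - 1) * ((n + 1) / 2 - 1))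

theorem mul_le_of_add_le {x y n : ℕ} (h : x + y ≤ n) : x * y ≤ n / 2 * ((n + 1) / 2) := by
  obtain ⟨k, rfl | rfl⟩ : ∃ k, n = 2 * k ∨ n = 2 * k + 1 := ⟨n / 2, by omega⟩
  · have h1 : 2 * k / 2 = k := by omega
    have h2 : (2 * k + 1) / 2 = k := by omega
    rw [h1, h2]
    zify at *
    nlinarith [sq_nonneg ((x : ℤ) - y)]
  · have h1 : (2 * k + 1) / 2 = k := by omega
    have h2 : (2 * k + 1 + 1) / 2 = k + 1 := by omega
    rw [h1, h2]
    rcases Nat.lt_or_ge k x with hx | hx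
    · obtain ⟨z, rfl⟩ := Nat.exists_eq_add_of_lt hx
      have hy : y + z ≤ k := by omega
      obtain ⟨w, rfl⟩ := Nat.exists_eq_add_of_le hy
      nlinarith [Nat.zero_le (z * z), Nat.zero_le (z * w), Nat.zero_le (z * y)]
    · obtain ⟨z, rfl⟩ := Nat.exists_eq_add_of_le hx
      have hy : y ≤ x + z + z + 1 := by omega
      nlinarith [Nat.zero_le (z * z)]

section
variable {V : Type*} [Fintype V] {G : SimpleGraph V}

open scoped Classical in
theorem card_labelledPaths_le_of_cliqueFree (hG : G.CliqueFree 3) :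
    #(labelledPaths G) ≤ 2 * bipartitePaths (Fintype.card V) := by
  set n := Fintype.card V with hn
  let t : Finset (Σ _ : V, V) := univ.sigma fun b => G.neighborFinset b
  have ht : #t ≤ 2 * (n / 2 * ((n + 1) / 2)) := by
    have h1 : #t = 2 * #G.edgeFinset := by
      rw [card_sigma, ← G.sum_degrees_eq_twice_card_edges]
      rfl
    have h2 := hG.card_edgeFinset_le
    simp only [← hn] at h2
    -- Turán's bound for two parts is `⌊n/2⌋⌈n/2⌉`.
    have h3 : (n ^ 2 - (n % 2) ^ 2) * (2 - 1) / (2 * 2) + (n % 2).choose 2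
        = n / 2 * ((n + 1) / 2) := by
      obtain ⟨k, hk | hk⟩ : ∃ k, n = 2 * k ∨ n = 2 * k + 1 := ⟨n / 2, by omega⟩
      · have e1 : n / 2 = k := by omega
        have e2 : (n + 1) / 2 = k := by omega
        have e3 : n % 2 = 0 := by omega
        rw [e1, e2, e3, hk, show (2 * k) ^ 2 - 0 ^ 2 = k * k * 4 by simp; ring]
        simp
      · have e1 : n / 2 = k := by omega
        have e2 : (n + 1) / 2 = k + 1 := by omega
        have e3 : n % 2 = 1 := by omega
        rw [e1, e2, e3, hk, show (2 * k + 1) ^ 2 - 1 ^ 2 = k * (k + 1) * 4 by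
          rw [show (2 * k + 1) ^ 2 = k * (k + 1) * 4 + 1 ^ 2 by ring, Nat.add_sub_cancel]]
        simp
    omega
  have key : #(labelledPaths G) ≤ ((n / 2 - 1) * ((n + 1) / 2 - 1)) * #t := by
    refine card_le_mul_card_image_of_maps_to (f := fun q => ⟨q.2.1, q.2.2.1⟩) ?_ _ ?_
    · rintro ⟨a, b, c, d⟩ hq
      simpa [t] using (mem_labelledPaths.1 hq).2.1
    · rintro ⟨b, c⟩ hbc
      have hbc : G.Adj b c := by simpa [t] using hbc
      -- A common neighbor of `b` and `c` would close a triangle.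
      have hdisj : Disjoint (G.neighborFinset b) (G.neighborFinset c) := by
        rw [Finset.disjoint_left]
        intro x hxb hxc
        rw [mem_neighborFinset] at hxb hxc
        exact hG {b, c, x} (is3Clique_triple_iff.2 ⟨hbc, hxb, hxc⟩)
      have hsum : G.degree b + G.degree c ≤ n := by
        rw [← card_neighborFinset_eq_degree, ← card_neighborFinset_eq_degree,
          ← card_union_of_disjoint hdisj]
        exact card_le_univ _
      have hb : 0 < G.degree b := (G.degree_pos_iff_exists_adj b).2 ⟨c, hbc⟩
      have hc : 0 < G.degree c := (G.degree_pos_iff_exists_adj c).2 ⟨b, hbc.symm⟩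
      calc _ ≤ #((((G.neighborFinset b).erase c) ×ˢ ((G.neighborFinset c).erase b)).image
              fun p : V × V => (p.1, b, c, p.2)) := by
            refine card_le_card ?_
            rintro ⟨a, b', c', d⟩ hq
            obtain ⟨hq', he⟩ := mem_filter.1 hq
            simp only [Sigma.mk.injEq, heq_eq_eq] at he
            obtain ⟨rfl, rfl⟩ := he
            obtain ⟨h1, h2, h3, h4, h5, h6⟩ := mem_labelledPaths.1 hq'
            exact mem_image.2 ⟨(a, d), by simp [h1.symm, h3, h4, h5.symm], rfl⟩
        _ ≤ (G.degree b - 1) * (G.degree c - 1) := by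
            refine card_image_le.trans ?_
            rw [card_product, card_erase_of_mem (by simpa using hbc),
              card_erase_of_mem (by simpa using hbc.symm), card_neighborFinset_eq_degree,
              card_neighborFinset_eq_degree]
        _ ≤ _ := by
            -- The two factors sum to at most `n - 2`, both degrees being positive.
            refine (mul_le_of_add_le (n := n - 2) (by omega)).trans_eq ?_
            congr 1 <;> omega
  calc _ ≤ _ := key
    _ ≤ ((n / 2 - 1) * ((n + 1) / 2 - 1)) * (2 * (n / 2 * ((n + 1) / 2))) := by gcongr
    _ = _ := by rw [bipartitePaths]; ring

theorem labelledTriangles_eq_empty (hG : G.CliqueFree 3) : labelledTriangles G = ∅ := by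
  classical
  rw [eq_empty_iff_forall_notMem]
  rintro ⟨a, b, c⟩ h
  obtain ⟨h1, h2, h3⟩ := mem_labelledTriangles.1 h
  exact hG {a, b, c} (is3Clique_triple_iff.2 ⟨h1, h3, h2⟩)

/-! ### The cost of deleting a vertex -/

open scoped Classical in
theorem card_labelledPaths_le_induce (v : V) :
    #(labelledPaths G) ≤ #(labelledPaths (G.induce {x | x ≠ v})) +
      2 * ((Fintype.card V + G.degree v) * ∑ b ∈ G.neighborFinset v, G.degree b) := by
  set S := labelledPaths G
  set p : V × V × V × V → Prop := fun q => q.1 ≠ v ∧ q.2.1 ≠ v ∧ q.2.2.1 ≠ v ∧ q.2.2.2 ≠ v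
  have hp1 : #(S.filter p) ≤ #(labelledPaths (G.induce {x | x ≠ v})) := by
    refine card_le_card_of_surjOn (fun q => (q.1.1, q.2.1.1, q.2.2.1.1, q.2.2.2.1)) ?_
    rintro ⟨a, b, c, d⟩ hq
    obtain ⟨hq, ha, hb, hc, hd⟩ := mem_filter.1 hq
    obtain ⟨h1, h2, h3, h4, h5, h6⟩ := mem_labelledPaths.1 hq
    refine ⟨(⟨a, ha⟩, ⟨b, hb⟩, ⟨c, hc⟩, ⟨d, hd⟩), mem_labelledPaths.2 ?_, rfl⟩
    simp [h1, h2, h3, h4, h5, h6]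
  let R : Finset (Σ _ : V, V) := (G.neighborFinset v).sigma fun b => G.neighborFinset b
  have hR : #R = ∑ b ∈ G.neighborFinset v, G.degree b := by
    rw [card_sigma]
    rfl
  have hp2 : #(S.filter fun q => ¬ p q) ≤ 2 * (#R * Fintype.card V) + 2 * (G.degree v * #R) := by
    -- `R` is the set of walks of length two from `v`. If `v` is an end of the path, such a walk is
    -- extended by any vertex; if `v` is inner, it is extended by a neighbor on the other side of
    -- `v`.
    have hsub : (S.filter fun q => ¬ p q) ⊆
        ((R ×ˢ univ).image (fun x : (Σ _ : V, V) × V => (v, x.1.1, x.1.2, x.2)) ∪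
          (R ×ˢ univ).image (fun x : (Σ _ : V, V) × V => (x.2, x.1.2, x.1.1, v))) ∪
        ((G.neighborFinset v ×ˢ R).image (fun x : V × (Σ _ : V, V) => (x.1, v, x.2.1, x.2.2)) ∪
          (G.neighborFinset v ×ˢ R).image
            (fun x : V × (Σ _ : V, V) => (x.2.2, x.2.1, v, x.1))) := by
      rintro ⟨a, b, c, d⟩ hq
      obtain ⟨hq, hp⟩ := mem_filter.1 hq
      obtain ⟨h1, h2, h3, h4, h5, h6⟩ := mem_labelledPaths.1 hq
      rw [mem_union, mem_union, mem_union]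
      by_cases ha : a = v
      · subst ha
        exact .inl (.inl (mem_image.2 ⟨(⟨b, c⟩, d), by simp [R, h1, h2], rfl⟩))
      by_cases hd : d = v
      · subst hd
        exact .inl (.inr (mem_image.2 ⟨(⟨c, b⟩, a), by simp [R, h3.symm, h2.symm], rfl⟩))
      by_cases hb : b = v
      · subst hb
        exact .inr (.inl (mem_image.2 ⟨(a, ⟨c, d⟩), by simp [R, h1.symm, h2, h3], rfl⟩))
      by_cases hc : c = v
      · subst hc
        exact .inr (.inr (mem_image.2 ⟨(d, ⟨b, a⟩), by simp [R, h1.symm, h2.symm, h3], rfl⟩))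
      exact absurd ⟨ha, hb, hc, hd⟩ hp
    have hc : ∀ {α : Type _} (s : Finset α) (f : α → V × V × V × V) (m : ℕ), #s = m →
        #(s.image f) ≤ m := fun s f m h => h ▸ card_image_le
    refine (card_le_card hsub).trans ((card_union_le _ _).trans ?_)
    have a1 := card_union_le
      ((R ×ˢ univ).image (fun x : (Σ _ : V, V) × V => (v, x.1.1, x.1.2, x.2)))
      ((R ×ˢ univ).image (fun x : (Σ _ : V, V) × V => (x.2, x.1.2, x.1.1, v)))
    have a2 := card_union_le
      ((G.neighborFinset v ×ˢ R).image (fun x : V × (Σ _ : V, V) => (x.1, v, x.2.1, x.2.2)))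
      ((G.neighborFinset v ×ˢ R).image (fun x : V × (Σ _ : V, V) => (x.2.2, x.2.1, v, x.1)))
    have e1 : #(R ×ˢ (univ : Finset V)) = #R * Fintype.card V := by
      rw [card_product, card_univ]
    have e2 : #(G.neighborFinset v ×ˢ R) = G.degree v * #R := by
      rw [card_product, card_neighborFinset_eq_degree]
    have b1 := hc _ (fun x : (Σ _ : V, V) × V => (v, x.1.1, x.1.2, x.2)) _ e1
    have b2 := hc _ (fun x : (Σ _ : V, V) × V => (x.2, x.1.2, x.1.1, v)) _ e1
    have b3 := hc _ (fun x : V × (Σ _ : V, V) => (x.1, v, x.2.1, x.2.2)) _ e2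
    have b4 := hc _ (fun x : V × (Σ _ : V, V) => (x.2.2, x.2.1, v, x.1)) _ e2
    omega
  have h3 := card_filter_add_card_filter_not (s := S) p
  rw [← hR]
  nlinarith

open scoped Classical in
theorem card_labelledTriangles_le_induce (v : V) :
    #(labelledTriangles G) ≤ #(labelledTriangles (G.induce {x | x ≠ v})) +
      3 * Fintype.card V ^ 2 := by
  set S := labelledTriangles G
  set p : V × V × V → Prop := fun q => q.1 ≠ v ∧ q.2.1 ≠ v ∧ q.2.2 ≠ v
  have h1 : #(S.filter p) ≤ #(labelledTriangles (G.induce {x | x ≠ v})) := by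
    refine card_le_card_of_surjOn (fun q => (q.1.1, q.2.1.1, q.2.2.1)) ?_
    rintro ⟨a, b, c⟩ hq
    obtain ⟨hq, ha, hb, hc⟩ := mem_filter.1 hq
    obtain ⟨h1, h2, h3⟩ := mem_labelledTriangles.1 hq
    refine ⟨(⟨a, ha⟩, ⟨b, hb⟩, ⟨c, hc⟩), mem_labelledTriangles.2 ?_, rfl⟩
    simp [h1, h2, h3]
  have h2 : #(S.filter fun q => ¬ p q) ≤ 3 * Fintype.card V ^ 2 := by
    have hsub : (S.filter fun q => ¬ p q) ⊆
        univ.image (fun x : V × V => (v, x.1, x.2)) ∪ (univ.image (fun x : V × V => (x.1, v, x.2)) ∪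
          univ.image (fun x : V × V => (x.1, x.2, v))) := by
      rintro ⟨a, b, c⟩ hq
      have hp := (mem_filter.1 hq).2
      simp only [p] at hp
      simp only [mem_union, mem_image, mem_univ, true_and, Prod.exists, Prod.mk.injEq]
      grind
    have hc : ∀ f : V × V → V × V × V, #(univ.image f) ≤ Fintype.card V ^ 2 := fun f => by
      refine card_image_le.trans ?_
      rw [card_univ, Fintype.card_prod, sq]
    have a1 := card_union_le (univ.image (fun x : V × V => (v, x.1, x.2)))
      (univ.image (fun x : V × V => (x.1, v, x.2)) ∪ univ.image (fun x : V × V => (x.1, x.2, v)))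
    have a2 := card_union_le (univ.image (fun x : V × V => (x.1, v, x.2)))
      (univ.image (fun x : V × V => (x.1, x.2, v)))
    have b1 := hc (fun x => (v, x.1, x.2))
    have b2 := hc (fun x => (x.1, v, x.2))
    have b3 := hc (fun x => (x.1, x.2, v))
    have := card_le_card hsub
    omega
  have h3 := card_filter_add_card_filter_not (s := S) p
  omega

end

/-! ### Paths in the balanced complete bipartite graph -/

theorem card_fin_filter_mod_two (n : ℕ) :
    #{x : Fin n | (x : ℕ) % 2 = 0} = (n + 1) / 2 ∧ #{x : Fin n | (x : ℕ) % 2 = 1} = n / 2 := by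
  have h (i : ℕ) : #{x : Fin n | (x : ℕ) % 2 = i} = #{x ∈ range n | x % 2 = i} := by
    rw [← card_map Fin.valEmbedding]
    congr 1
    ext x
    simp only [mem_map, mem_filter, mem_univ, true_and, Fin.valEmbedding_apply, mem_range]
    exact ⟨fun ⟨a, ha, hx⟩ => hx ▸ ⟨a.2, ha⟩, fun ⟨hx, h⟩ => ⟨⟨x, hx⟩, h, rfl⟩⟩
  rw [h, h]
  clear h
  induction n with
  | zero => simp
  | succ n ih =>
    rw [range_add_one, filter_insert, filter_insert]
    rcases Nat.mod_two_eq_zero_or_one n with hn | hn <;>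
      simp only [hn, if_true, zero_ne_one, one_ne_zero, if_false] <;>
      rw [card_insert_of_notMem (by simp)] <;> omega

theorem le_card_labelledPaths_turanGraph (n : ℕ) :
    2 * bipartitePaths n ≤ #(labelledPaths (turanGraph n 2)) := by
  classical
  let S (i : ℕ) : Finset (Fin n) := {x | (x : ℕ) % 2 = i}
  have hS0 : #(S 0) = (n + 1) / 2 := (card_fin_filter_mod_two n).1
  have hS1 : #(S 1) = n / 2 := (card_fin_filter_mod_two n).2
  let f : ((Fin n × Fin n) × (Fin n × Fin n)) → Fin n × Fin n × Fin n × Fin n :=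
    fun x => (x.1.1, x.2.1, x.1.2, x.2.2)
  have hf : Function.Injective f := by
    rintro ⟨⟨a, b⟩, ⟨c, d⟩⟩ ⟨⟨a', b'⟩, ⟨c', d'⟩⟩ h
    simp only [f, Prod.mk.injEq] at h
    simp [h]
  -- A path alternates between the classes, so it interleaves an ordered pair of distinct vertices
  -- of each; `A` and `B` differ in the class of the first vertex.
  let A := ((S 0).offDiag ×ˢ (S 1).offDiag).image f
  let B := ((S 1).offDiag ×ˢ (S 0).offDiag).image f
  have hAB : Disjoint A B := by
    rw [Finset.disjoint_left]
    rintro ⟨a, b, c, d⟩ hA hB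
    simp only [A, B, f, S, mem_image, mem_product, mem_offDiag, mem_filter, mem_univ, true_and,
      Prod.exists, Prod.mk.injEq] at hA hB
    grind
  have hsub : A ∪ B ⊆ labelledPaths (turanGraph n 2) := by
    rintro ⟨a, b, c, d⟩ h
    rw [mem_labelledPaths]
    simp only [A, B, f, S, mem_union, mem_image, mem_product, mem_offDiag, mem_filter, mem_univ,
      true_and, Prod.exists, Prod.mk.injEq] at h
    simp only [turanGraph]
    grind
  have hc := card_le_card hsub
  rw [card_union_of_disjoint hAB, card_image_of_injective _ hf, card_image_of_injective _ hf,
    card_product, card_product, offDiag_card, offDiag_card, hS0, hS1] at hc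
  refine le_trans (le_of_eq ?_) hc
  rw [bipartitePaths, ← Nat.mul_sub_one, ← Nat.mul_sub_one]
  ring

/-! ### `C₅`-free graphs containing a triangle -/

section
variable {V : Type*} [Fintype V] {G : SimpleGraph V}

open scoped Classical in
/-- In a `C₅`-free graph, a neighborhood spans linearly many edges. -/
theorem sum_card_inter_neighborFinset_le (hG : (cycleGraph 5).Free G) (v : V) :
    ∑ b ∈ G.neighborFinset v, #(G.neighborFinset b ∩ G.neighborFinset v) ≤ 4 * G.degree v := by
  set S := G.neighborFinset v with hS
  set k : V → ℕ := fun b => #(G.neighborFinset b ∩ S)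
  have hk (b : V) : k b = ∑ c ∈ S, if G.Adj b c then 1 else 0 := by
    rw [← card_filter]
    exact congrArg card (by ext c; simp [and_comm])
  -- Otherwise the edge `xy` extends to a path `x' x y y'` inside the neighborhood, and `v` closes
  -- it to a five-cycle. Hence each edge can be charged to an endpoint with at most two neighbors in
  -- `S`.
  have claim : ∀ x ∈ S, ∀ y ∈ S, G.Adj x y → k x ≤ 2 ∨ k y ≤ 2 := by
    intro x hx y hy hxy
    by_contra! h
    rw [hS, mem_neighborFinset] at hx hy
    obtain ⟨x', hx', hx'y⟩ := exists_mem_notMem_of_card_lt_card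
      (s := {y}) (t := G.neighborFinset x ∩ S) (Nat.lt_of_succ_lt h.1)
    obtain ⟨y', hy', hy'x⟩ := exists_mem_notMem_of_card_lt_card
      (s := {x, x'}) (t := G.neighborFinset y ∩ S) (card_le_two.trans_lt h.2)
    simp only [hS, mem_inter, mem_neighborFinset, mem_insert, mem_singleton, not_or]
      at hx' hx'y hy' hy'x
    exact not_cycle_five hG hx'.2 hx'.1.symm hxy hy'.1 hy'.2.symm hx.ne hy.ne hx'y
      (Ne.symm hy'x.2) (Ne.symm hy'x.1)
  calc ∑ b ∈ S, k b = ∑ b ∈ S, ∑ c ∈ S, if G.Adj b c then 1 else 0 :=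
        sum_congr rfl fun b _ => hk b
    _ ≤ ∑ b ∈ S, ∑ c ∈ S, ((if G.Adj b c ∧ k b ≤ 2 then 1 else 0) +
          if G.Adj c b ∧ k c ≤ 2 then 1 else 0) := by
        refine sum_le_sum fun b hb => sum_le_sum fun c hc => ?_
        by_cases h : G.Adj b c
        · rcases claim b hb c hc h with h' | h' <;> simp [h, h.symm, h']
        · simp [h]
    _ = 2 * ∑ b ∈ S, ∑ c ∈ S, if G.Adj b c ∧ k b ≤ 2 then 1 else 0 := by
        simp_rw [sum_add_distrib]
        rw [sum_comm (f := fun b c => if G.Adj c b ∧ k c ≤ 2 then 1 else 0), two_mul]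
    _ ≤ 2 * ∑ b ∈ S, 2 := by
        gcongr with b hb
        by_cases h : k b ≤ 2
        · simp only [h, and_true]
          rwa [← hk]
        · simp [h]
    _ = 4 * G.degree v := by
        rw [sum_const, hS, card_neighborFinset_eq_degree, smul_eq_mul]
        ring

open scoped Classical in
theorem sum_degree_neighborFinset_add_le (hG : (cycleGraph 5).Free G) {v w t : V}
    (hvw : G.Adj v w) (hvt : G.Adj v t) (hwt : G.Adj w t) (hd : G.degree v ≤ G.degree w)
    (hc : #(G.neighborFinset v ∩ G.neighborFinset w) ≤ 2) :
    ∑ b ∈ G.neighborFinset v, G.degree b + 2 * G.degree v ^ 2 ≤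
      G.degree v * Fintype.card V + 12 * Fintype.card V := by
  set n := Fintype.card V
  set δ := G.degree v
  have hdeg (b : V) : G.degree b ≤ n := (G.degree_lt_card_verts b).le
  -- The vertices `w` and `t` are exempt from the cycle argument; the summand `2 * n` pays for each
  -- trivially.
  have hb : ∀ b ∈ G.neighborFinset v, G.degree b + 2 * δ ≤
      #(G.neighborFinset b ∩ G.neighborFinset v) + (n + 4) +
        ((if b = w then 2 * n else 0) + if b = t then 2 * n else 0) := by
    intro b hb
    rw [mem_neighborFinset] at hb
    have h1 := hdeg b
    have h2 : δ ≤ n := hdeg v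
    by_cases hbw : b = w
    · simp only [hbw, if_true] at *
      omega
    by_cases hbt : b = t
    · simp only [hbt, if_true] at *
      omega
    simp only [hbw, hbt, if_false, add_zero]
    -- A neighbor `y ≠ v, t` of `b` that is adjacent to `w` but not to `v` gives the cycle `v b y w
    -- t`. The complement here has at most `n - 2δ + 2` elements, because `deg w ≥ δ` and `v`, `w`
    -- have at most two common neighbors.
    have hsub : G.neighborFinset b ⊆ ((G.neighborFinset b ∩ G.neighborFinset v) ∪
        (G.neighborFinset v ∪ G.neighborFinset w)ᶜ) ∪ {v, t} := by
      intro y hy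
      simp only [mem_union, mem_inter, mem_compl, mem_insert, mem_singleton, mem_neighborFinset]
        at hy ⊢
      by_contra! h
      have hyv : ¬ G.Adj v y := fun h' => h.1.1 hy h'
      have hyw : G.Adj w y := h.1.2.resolve_left hyv
      exact not_cycle_five hG hb hy hyw.symm hwt hvt.symm h.2.1.symm hvw.ne hbw hbt h.2.2
    have h3 := (card_le_card hsub).trans ((card_union_le _ _).trans
      (Nat.add_le_add (card_union_le _ _) (card_le_two (a := v) (b := t))))
    have h4 := card_compl_add_card (G.neighborFinset v ∪ G.neighborFinset w)
    have h5 := card_union_add_card_inter (G.neighborFinset v) (G.neighborFinset w)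
    rw [card_neighborFinset_eq_degree, card_neighborFinset_eq_degree] at h5
    rw [card_neighborFinset_eq_degree] at h3
    omega
  have hsum := sum_le_sum hb
  rw [sum_add_distrib, sum_add_distrib, sum_add_distrib, sum_add_distrib, sum_add_distrib,
    sum_ite_eq', sum_ite_eq', sum_const, sum_const, sum_const, card_neighborFinset_eq_degree, smul_eq_mul, smul_eq_mul,
    smul_eq_mul, if_pos (by simpa using hvw), if_pos (by simpa using hvt)] at hsum
  have := sum_card_inter_neighborFinset_le hG v
  have := hdeg v
  nlinarith

-- If both bounds failed, distinct vertices `x`, `y` outside the triangle could be chosen with `x`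
-- adjacent to `a`, `b` and `y` adjacent to `a`, `c`, giving the cycle `a x b c y`.
open scoped Classical in
theorem card_inter_neighborFinset_le_two_or (hG : (cycleGraph 5).Free G) {a b c : V}
    (hab : G.Adj a b) (hac : G.Adj a c) (hbc : G.Adj b c) :
    #(G.neighborFinset a ∩ G.neighborFinset b) ≤ 2 ∨
      #(G.neighborFinset a ∩ G.neighborFinset c) ≤ 2 := by
  by_contra! h
  obtain ⟨y, hy, hyb⟩ := exists_mem_notMem_of_card_lt_card (s := {b})
    (t := G.neighborFinset a ∩ G.neighborFinset c) (by rw [card_singleton]; omega)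
  obtain ⟨x, hx, hxc⟩ := exists_mem_notMem_of_card_lt_card (s := {c, y})
    (t := G.neighborFinset a ∩ G.neighborFinset b) (card_le_two.trans_lt h.1)
  simp only [mem_inter, mem_neighborFinset, mem_insert, mem_singleton, not_or] at hx hxc hy hyb
  exact not_cycle_five hG hx.1 hx.2.symm hbc hy.2 hy.1.symm hab.ne hac.ne hxc.1 hxc.2
    (Ne.symm hyb)

open scoped Classical in
/-- A `C₅`-free graph with a triangle has a vertex from which few walks of length two start. -/
theorem exists_sum_degree_neighborFinset_add_le (hG : (cycleGraph 5).Free G)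
    (h3 : ¬ G.CliqueFree 3) :
    ∃ v, ∑ b ∈ G.neighborFinset v, G.degree b + 2 * G.degree v ^ 2 ≤
      G.degree v * Fintype.card V + 12 * Fintype.card V := by
  -- The vertex sought is one of least degree in a triangle.
  have key : ∀ {a b c : V}, G.Adj a b → G.Adj a c → G.Adj b c → G.degree a ≤ G.degree b →
      G.degree a ≤ G.degree c → ∑ x ∈ G.neighborFinset a, G.degree x + 2 * G.degree a ^ 2 ≤
        G.degree a * Fintype.card V + 12 * Fintype.card V := by
    intro a b c hab hac hbc h1 h2
    rcases card_inter_neighborFinset_le_two_or hG hab hac hbc with h | h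
    · exact sum_degree_neighborFinset_add_le hG hab hac hbc h1 h
    · exact sum_degree_neighborFinset_add_le hG hac hab hbc.symm h2 h
  simp only [CliqueFree, not_forall, not_not] at h3
  obtain ⟨s, hs⟩ := h3
  obtain ⟨a, b, c, hab, hac, hbc, -⟩ := is3Clique_iff.1 hs
  rcases le_total (G.degree a) (G.degree b) with h1 | h1 <;>
    rcases le_total (G.degree b) (G.degree c) with h2 | h2 <;>
    rcases le_total (G.degree a) (G.degree c) with h3 | h3
  · exact ⟨a, key hab hac hbc h1 h3⟩
  · exact ⟨a, key hab hac hbc h1 (h1.trans h2)⟩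
  · exact ⟨a, key hab hac hbc h1 h3⟩
  · exact ⟨c, key hac.symm hbc.symm hab h3 h2⟩
  · exact ⟨b, key hab.symm hbc hac h1 h2⟩
  · exact ⟨b, key hab.symm hbc hac h1 h2⟩
  · exact ⟨c, key hac.symm hbc.symm hab (h2.trans h1) h2⟩
  · exact ⟨c, key hac.symm hbc.symm hab h3 h2⟩

end

/-! ### Induction by deleting vertices -/

theorem cube_add_bipartitePaths_le {n : ℕ} (hn : 2 ≤ n) :
    (n + 1) ^ 3 + 4 * bipartitePaths n ≤ 4 * bipartitePaths (n + 1) + 7 * (n + 1) ^ 2 := by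
  obtain ⟨j, rfl | rfl⟩ : ∃ j, n = 2 * j + 2 ∨ n = 2 * j + 3 := ⟨(n - 2) / 2, by omega⟩
  · have e1 : (2 * j + 2) / 2 = j + 1 := by omega
    have e2 : (2 * j + 2 + 1) / 2 = j + 1 := by omega
    have e3 : (2 * j + 2 + 1 + 1) / 2 = j + 2 := by omega
    simp only [bipartitePaths, e1, e2, e3, Nat.add_sub_cancel, show j + 2 - 1 = j + 1 by omega]
    nlinarith
  · have e1 : (2 * j + 3) / 2 = j + 1 := by omega
    have e2 : (2 * j + 3 + 1) / 2 = j + 2 := by omega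
    have e3 : (2 * j + 3 + 1 + 1) / 2 = j + 2 := by omega
    simp only [bipartitePaths, e1, e2, e3, Nat.add_sub_cancel, show j + 2 - 1 = j + 1 by omega]
    nlinarith

/-- Here `f` and `f'` stand for `bipartitePaths` at `n` and `n - 1`. The loss `2(n + δ)W` is at most
`2n³/5 + 48n²`, against a gain of at least `n³/2 - 7n²/2`; the lower bound on `n` absorbs the
quadratic terms. The summand `1` is the progress made by each deletion. -/
theorem deletion_arith {c n δ W : ℕ} (hn : 1000 + 100 * c ≤ n) (hδ : δ ≤ n)
    (hW : W + 2 * δ ^ 2 ≤ δ * n + 12 * n) {f f' : ℕ} (hf : n ^ 3 + 4 * f' ≤ 4 * f + 7 * n ^ 2) :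
    2 * ((n + δ) * W) + c * (3 * n ^ 2) + 1 + 2 * f' ≤ 2 * f := by
  have h1 : 5 * ((n + δ) * W) ≤ n ^ 3 + 120 * n ^ 2 := by
    have h2 : (n + δ) * (W + 2 * δ ^ 2) ≤ (n + δ) * (δ * n + 12 * n) := by gcongr
    have h3 : δ * n ≤ n * n := by gcongr
    -- With `x = δ/n` this is `(1 + x)(x - 2x²) ≤ 1/5`. The left side peaks near `x = 0.27`, at
    -- about `0.16`, so the squares are chosen to vanish near there.
    have h4 : 5 * n ^ 2 * δ ≤ n ^ 3 + 5 * n * δ ^ 2 + 10 * δ ^ 3 := by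
      zify
      have hn0 : (0 : ℤ) ≤ n := by positivity
      have hδ0 : (0 : ℤ) ≤ δ := by positivity
      nlinarith [mul_nonneg hn0 (sq_nonneg ((n : ℤ) - 3 * δ)),
        mul_nonneg hδ0 (sq_nonneg ((n : ℤ) - 3 * δ)), mul_nonneg hn0 (sq_nonneg ((n : ℤ) - 4 * δ)),
        mul_nonneg hδ0 (sq_nonneg ((n : ℤ) - 4 * δ)), mul_nonneg hn0 (sq_nonneg (2 * (n : ℤ) - 7 * δ)),
        mul_nonneg hδ0 (sq_nonneg (2 * (n : ℤ) - 7 * δ))]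
    nlinarith
  have h5 : (1000 + 100 * c) * n ^ 2 ≤ n * n ^ 2 := by gcongr
  have h6 : 1 ≤ n ^ 2 := Nat.one_le_pow _ _ (by omega)
  nlinarith

theorem exists_card_labelledPaths_add_le (c : ℕ) :
    ∃ N, ∀ (V : Type) [Fintype V] (G : SimpleGraph V), (cycleGraph 5).Free G →
      N ≤ Fintype.card V →
      #(labelledPaths G) + c * #(labelledTriangles G) ≤ 2 * bipartitePaths (Fintype.card V) := by
  classical
  set m := 1000 + 100 * c with hm
  -- `M` is the trivial bound on `m` vertices. The allowed excess `M - d` shrinks with each added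
  -- vertex, and truncated subtraction keeps it at zero from `d = M` on.
  set M := m ^ 4 + c * m ^ 3 with hM
  have main : ∀ d : ℕ, ∀ (V : Type) [Fintype V] (G : SimpleGraph V), (cycleGraph 5).Free G →
      Fintype.card V = m + d →
      #(labelledPaths G) + c * #(labelledTriangles G) ≤
        2 * bipartitePaths (m + d) + (M - d) := by
    intro d
    induction d with
    | zero =>
      intro V _ G _ hV
      have h1 : #(labelledPaths G) ≤ m ^ 4 := by
        refine (card_le_univ _).trans_eq ?_
        simp only [Fintype.card_prod, hV]
        ring
      have h2 : #(labelledTriangles G) ≤ m ^ 3 := by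
        refine (card_le_univ _).trans_eq ?_
        simp only [Fintype.card_prod, hV]
        ring
      have h3 : c * #(labelledTriangles G) ≤ c * m ^ 3 := by gcongr
      omega
    | succ d ih =>
      intro V _ G hG hV
      by_cases h3 : G.CliqueFree 3
      · have := card_labelledPaths_le_of_cliqueFree h3
        rw [labelledTriangles_eq_empty h3, card_empty, ← hV]
        omega
      obtain ⟨v, hv⟩ := exists_sum_degree_neighborFinset_add_le hG h3
      have hV' : Fintype.card ({x | x ≠ v} : Set V) = m + d := by
        simp only [Set.coe_ofPred, ne_eq, Fintype.card_subtype_compl, Fintype.card_unique, hV]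
        omega
      have hG' : (cycleGraph 5).Free (G.induce {x | x ≠ v}) :=
        fun h => hG (h.trans ⟨Copy.induce G _⟩)
      have h4 := ih _ _ hG' hV'
      have h5 := card_labelledPaths_le_induce (G := G) v
      have h6 := Nat.mul_le_mul_left c (card_labelledTriangles_le_induce (G := G) v)
      have h7 := deletion_arith (c := c) (by omega) (G.degree_lt_card_verts v).le hv
        (hV ▸ cube_add_bipartitePaths_le (n := m + d) (by omega))
      rw [hV] at h5 h6 h7
      rw [mul_add] at h6
      have h8 : m + (d + 1) = m + d + 1 := rfl
      omega
  refine ⟨m + M, fun V _ G hG hV => ?_⟩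
  obtain ⟨d, hd⟩ := Nat.exists_eq_add_of_le hV
  have := main (M + d) V G hG (by omega)
  rw [← add_assoc, ← hd] at this
  omega

/-! ### From labelled counts to the extremal numbers -/

/-- For large `n`, the graph `T₂(n)` has at least as many copies of `P₄` as a `C₅`-free graph has
copies of `P₄` and `K₃` together. -/
theorem exists_copyCount_add_le :
    ∃ N, ∀ n, N ≤ n → ∀ G : SimpleGraph (Fin n), (cycleGraph 5).Free G →
      G.copyCount (pathGraph 4) + G.copyCount (completeGraph (Fin 3)) ≤
        (turanGraph n 2).copyCount (pathGraph 4) := by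
  set α := Nat.card (pathGraph 4 ≃g pathGraph 4) with hα
  -- Each copy of `P₄` is labelled `α` times, so weighting triangles by `α` lets the factor cancel
  -- at the end.
  obtain ⟨N, hN⟩ := exists_card_labelledPaths_add_le α
  refine ⟨N, fun n hn G hG => ?_⟩
  have h1 := hN _ G hG (by simpa using hn)
  have h2 := le_card_labelledPaths_turanGraph n
  rw [Fintype.card_fin] at h1
  rw [← labelledCopyCount_pathGraph_four, labelledCopyCount_eq_mul, ← hα] at h1 h2
  have h3 : G.copyCount (completeGraph (Fin 3)) ≤ #(labelledTriangles G) :=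
    (copyCount_le_labelledCopyCount).trans (labelledCopyCount_completeGraph_three_le G)
  have h4 := Nat.mul_le_mul_left α h3
  refine Nat.le_of_mul_le_mul_right (?_ : _ * α ≤ _ * α) (natCard_iso_self_pos (pathGraph 4))
  rw [add_mul]
  linarith

theorem labelGraph_monochromatic {k n : ℕ} (G : SimpleGraph (Fin n)) (i : Fin k) :
    (monochromatic G i).labelGraph i = G := by
  ext x y
  simp [EdgeLabeling.labelGraph_adj, monochromatic]

theorem mem_freeGraphs {n : ℕ} {F : FinGraph} {G : SimpleGraph (Fin n)} :
    G ∈ freeGraphs n F ↔ F.2.Free G := by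
  simp [freeGraphs]

theorem exCol_le_iff {k n m : ℕ} {H : Fin k → FinGraph} {F : FinGraph} :
    exCol n H F ≤ m ↔ ∀ G : SimpleGraph (Fin n), F.2.Free G →
      ∀ c : G.EdgeLabeling (Fin k), colCount H c ≤ m := by
  simp [exCol, mem_freeGraphs]

end GenTuran

open GenTuran SimpleGraph Finset in
theorem mainTheorem6 :
    ∃ N : ℕ, ∀ n : ℕ, N ≤ n →
      GenTuran.IsResistant n ![GenTuran.P 4, GenTuran.K 3] (GenTuran.C 5) ∧
      GenTuran.IsColorResistant n ![GenTuran.P 4, GenTuran.K 3] (GenTuran.C 5) ∧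
      (GenTuran.C 5).2.Free (SimpleGraph.turanGraph n 2) ∧
      GenTuran.count ![GenTuran.P 4, GenTuran.K 3] (SimpleGraph.turanGraph n 2) =
        GenTuran.exTuple n ![GenTuran.P 4, GenTuran.K 3] (GenTuran.C 5) ∧
      GenTuran.colCount ![GenTuran.P 4, GenTuran.K 3]
          (GenTuran.monochromatic (SimpleGraph.turanGraph n 2) 0) =
        GenTuran.exCol n ![GenTuran.P 4, GenTuran.K 3] (GenTuran.C 5) := by
  obtain ⟨N, hN⟩ := exists_copyCount_add_le
  refine ⟨N, fun n hn => ?_⟩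
  set H : Fin 2 → FinGraph := ![P 4, K 3] with hH
  set T := turanGraph n 2 with hT
  set t := T.copyCount (pathGraph 4) with ht
  have hfree : (C 5).2.Free T := turanGraph_two_cycle_five_free n
  have hcount (G : SimpleGraph (Fin n)) :
      count H G = G.copyCount (pathGraph 4) + G.copyCount (completeGraph (Fin 3)) :=
    Fin.sum_univ_two _
  have hcol {G : SimpleGraph (Fin n)} (c : G.EdgeLabeling (Fin 2)) :
      colCount H c = (c.labelGraph 0).copyCount (pathGraph 4) +
        (c.labelGraph 1).copyCount (completeGraph (Fin 3)) :=
    Fin.sum_univ_two _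
  have hle (G : SimpleGraph (Fin n)) (hG : (C 5).2.Free G) : count H G ≤ t :=
    (hcount G).trans_le (hN n hn G hG)
  have hTcount : count H T = t := le_antisymm (hle T hfree) (by rw [hcount]; omega)
  have hexTuple : exTuple n H (C 5) = t := by
    refine le_antisymm (Finset.sup_le fun G hG => hle G (mem_freeGraphs.1 hG)) ?_
    exact hTcount.symm.trans_le (le_sup (f := fun G => count H G) (mem_freeGraphs.2 hfree))
  have hmaxEx : maxEx n H (C 5) = t := by
    refine le_antisymm (Finset.sup_le fun i _ => Finset.sup_le fun G hG => ?_) ?_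
    · exact (single_le_sum (f := fun i => G.copyCount (H i).2) (fun _ _ => Nat.zero_le _)
        (mem_univ i)).trans (hle G (mem_freeGraphs.1 hG))
    · exact (le_sup (f := fun G => G.copyCount (H 0).2) (mem_freeGraphs.2 hfree)).trans
        (le_sup (f := fun i => ex n (H i) (C 5)) (mem_univ 0))
  have hTcol : t ≤ colCount H (monochromatic T 0) := by
    rw [hcol, labelGraph_monochromatic]
    omega
  have hexCol : exCol n H (C 5) = t := by
    refine le_antisymm (exCol_le_iff.2 fun G hG c => ?_)
      (hTcol.trans (exCol_le_iff.1 le_rfl T hfree (monochromatic T 0)))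
    refine le_trans ?_ (hle G hG)
    exact sum_le_sum fun i _ => copyCount_mono (EdgeLabeling.labelGraph_le c) _
  refine ⟨⟨⟨T, hfree, 0, hmaxEx.symm⟩, fun G ⟨hG, j, hj⟩ => ?_⟩, hexCol.trans hmaxEx.symm, hfree,
    hTcount.trans hexTuple.symm, le_antisymm ?_ (hexCol.trans_le hTcol)⟩
  · rw [hexTuple]
    -- One of the two counts of `G` already equals `t`, and their sum is at most `t`.
    refine le_antisymm ?_ (hle G hG)
    rw [← hmaxEx, ← hj]
    exact single_le_sum (f := fun i => G.copyCount (H i).2) (fun _ _ => Nat.zero_le _) (mem_univ j)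
  · rw [hexCol]
    refine le_trans ?_ (hle T hfree)
    exact sum_le_sum fun i _ => copyCount_mono (EdgeLabeling.labelGraph_le _) _
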